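/- Let $G$ be a finite connected graph with $n\ge 1$ vertices (multiple edges allowed; the edges are oriented arbitrarily), with vertex set $V$ and edge set $E$, and let $T\subseteq E$ be a spanning forest (a maximal cycle-free set of edges; here a spanning tree). For $e\in E\setminus T$ let $\sigma^e\in\{0,\pm1\}^{E}$ be the sign vector of the unique path in $T$ from the head of $e$ to the tail of $e$ ($+1$ on edges traversed along their orientation, $-1$ on edges traversed against it, $0$ elsewhere), and let $C$ be the $T\times(E\setminus T)$ matrix with columns $\sigma^e|_T$. The tension polytope of $G$ with respect to $T$ is $$T_G=\{t\in\mathbb R^T \mid -1\le C^{t}t\le 1,\ -1\le t\le 1\}.$$ For a polynomial $p$ of degree $d$, its $h^*$-vector $(h^*_0(p),\dots,h^*_d(p))$ is defined by $(1-z)^{d+1}\sum_{k\ge0}p(k)z^k=\sum_{i=0}^d h^*_i(p)z^i$. The Ehrhart polynomial of a polytope $P\subset\mathbb R^m$ is the polynomial $L_P$ with $L_P(k)=|\mathbb Z^m\cap kP|$ for all integers $k\ge1$, and $h^*(P)=h^*(L_P)$. Let $$A(n,i)=\sum_{j=0}^{i}(-1)^j\binom{n+1}{j}(i-j)^n,\qquad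 B(n,i)=\sum_{j=1}^{i}(-1)^{i-j}\binom{n}{i-j}(2j-1)^{n-1}$$ be the Eulerian and MacMahon numbers. Then the Ehrhart polynomial $L_{T_G}$ exists and has degree $n-1$, and for $0\le i\le n-1$ $$A(n,i+1)=h^*_i\big((k+1)^n-k^n\big)\ \le\ h^*_i(T_G)\ \le\ h^*_i\big((2k+1)^{n-1}\big)=B(n,i+1).$$ Both bounds are tight for every $n\ge1$: for the complete graph $K_n$ (any orientation, any spanning tree) $L_{T_{K_n}}(k)=(k+1)^n-k^n$, so the lower bound is attained for all $i$ by $K_n$; for any tree $G$ on $n$ vertices $L_{T_G}(k)=(2k+1)^{n-1}$, so the upper bound is attained for all $i$ by every tree on $n$ vertices. -/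

import Mathlib

universe u v

open scoped Pointwise

noncomputable section

/-- A directed graph with vertex set `V` and edge set `E`; multiple edges and loops are allowed. -/
structure DirectedMultigraph (V E : Type*) where
  tail : E → V
  head : E → V

namespace DirectedMultigraph

variable {V E : Type*} (G : DirectedMultigraph V E)

/-- A step `(e, true)` traverses the edge `e` from tail to head, a step `(e, false)` from head
to tail. This is the vertex where the step starts. -/
def start (s : E × Bool) : V := if s.2 then G.tail s.1 else G.head s.1

/-- The vertex where a step ends. -/
def finish (s : E × Bool) : V := if s.2 then G.head s.1 else G.tail s.1

/-- The list of steps `l` is a walk from `u` to `v` in the underlying undirected graph. -/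
def IsWalk : V → List (E × Bool) → V → Prop
  | u, [], v => u = v
  | u, s :: l, v => G.start s = u ∧ IsWalk (G.finish s) l v

/-- A path: a walk that visits no vertex twice. -/
def IsPath (u : V) (l : List (E × Bool)) (v : V) : Prop :=
  G.IsWalk u l v ∧ (u :: l.map G.finish).Nodup

/-- A cycle: a nonempty closed walk that repeats no edge and no vertex (except that it returns
to its first vertex). A loop is a cycle, and so is a pair of parallel edges. -/
def IsCycle (u : V) (l : List (E × Bool)) : Prop :=
  l ≠ [] ∧ G.IsWalk u l u ∧ (l.map G.finish).Nodup ∧ (l.map Prod.fst).Nodup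

/-- The underlying undirected graph is connected (in particular it has a vertex). -/
def Connected : Prop := Nonempty V ∧ ∀ u v : V, ∃ l, G.IsWalk u l v

/-- The spanning subgraph with edge set `S` contains no cycle. -/
def IsCycleFree (S : Finset E) : Prop :=
  ∀ (u : V) (l : List (E × Bool)), (∀ s ∈ l, s.1 ∈ S) → ¬ G.IsCycle u l

/-- A spanning forest: a maximal cycle-free spanning subgraph, given by its edge set. -/
def IsSpanningForest (T : Finset E) : Prop := Maximal G.IsCycleFree T

/-- `G` is a tree (with some orientation): connected and without cycles. -/
def IsTree [Fintype E] : Prop := G.Connected ∧ G.IsCycleFree Finset.univ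

/-- `G` is an orientation of the complete graph on `V`: there are no loops, and any two distinct
vertices are joined by exactly one edge. -/
def IsComplete : Prop :=
  (∀ e, G.tail e ≠ G.head e) ∧
    ∀ u v : V, u ≠ v →
      ∃! e, (G.tail e = u ∧ G.head e = v) ∨ (G.tail e = v ∧ G.head e = u)

open scoped Classical in
/-- The sign vector of a path: `+1` on edges traversed along their orientation, `-1` on edges
traversed against it, and `0` on all other edges. -/
def signVector (l : List (E × Bool)) (e : E) : ℤ :=
  if (e, true) ∈ l then 1 else if (e, false) ∈ l then -1 else 0

open scoped Classical in
/-- For an edge `e` outside the spanning forest `T`, the path in `T` from the head of `e` to the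
tail of `e`. It exists and is unique when `T` is a spanning forest; the default `[]` is never
used in that case. -/
def treePath (T : Finset E) (e : E) : List (E × Bool) :=
  if h : ∃ l, G.IsPath (G.head e) l (G.tail e) ∧ ∀ s ∈ l, s.1 ∈ T then h.choose else []

/-- The matrix `C` with rows indexed by `T` and columns indexed by `E \ T`, whose column at `e`
is the restriction to `T` of the sign vector of the path in `T` from the head to the tail
of `e`. -/
def pathMatrix (T : Finset E) : Matrix T {e : E // e ∉ T} ℝ :=
  Matrix.of fun f e => (signVector (G.treePath T e) f : ℝ)

/-- The tension polytope `{t ∈ ℝ^T | -1 ≤ Cᵀ t ≤ 1, -1 ≤ t ≤ 1}` of `G` with respect to the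
spanning forest `T`. -/
def tensionPolytope (T : Finset E) : Set (T → ℝ) :=
  {t | (∀ e, -1 ≤ ((G.pathMatrix T).transpose.mulVec t) e ∧
      ((G.pathMatrix T).transpose.mulVec t) e ≤ 1) ∧ ∀ f, -1 ≤ t f ∧ t f ≤ 1}

end DirectedMultigraph

/-- The Ehrhart function `k ↦ |ℤ^ι ∩ k • A|` of a (bounded) set `A ⊆ ℝ^ι`. -/
def ehrhartFunction {ι : Type*} (A : Set (ι → ℝ)) (k : ℕ) : ℕ :=
  Set.ncard {x : ι → ℤ | (fun i => (x i : ℝ)) ∈ (k : ℝ) • A}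

/-- `p` is the Ehrhart polynomial of `A`: it agrees with the Ehrhart function at all positive
integers, which determines it uniquely. -/
def IsEhrhartPolynomial {ι : Type*} (A : Set (ι → ℝ)) (p : Polynomial ℚ) : Prop :=
  ∀ k : ℕ, 1 ≤ k → p.eval (k : ℚ) = (ehrhartFunction A k : ℚ)

/-- The entry `h*_i` of the `h*`-vector of a polynomial `p` of degree `d`, defined by
`(1 - z)^(d+1) ∑_{k ≥ 0} p(k) z^k = ∑_i h*_i z^i`. -/
def hStar (p : Polynomial ℚ) (i : ℕ) : ℚ :=
  PowerSeries.coeff i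
    ((1 - PowerSeries.X) ^ (p.natDegree + 1) * PowerSeries.mk fun k : ℕ => p.eval (k : ℚ))

/-- The Eulerian number `A(n, i)`. -/
def eulerianNumber (n i : ℕ) : ℤ :=
  ∑ j ∈ Finset.Icc 0 i, (-1) ^ j * ((n + 1).choose j : ℤ) * ((i : ℤ) - j) ^ n

/-- The MacMahon number `B(n, i)`, for `n ≥ 1`. -/
def macMahonNumber (n i : ℕ) : ℤ :=
  ∑ j ∈ Finset.Icc 1 i, (-1) ^ (i - j) * (n.choose (i - j) : ℤ) * (2 * (j : ℤ) - 1) ^ (n - 1)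

end

/-!
The lattice points of the `k`-th dilate of the tension polytope of a connected graph are the
integral tensions bounded by `k`. Since the spanning forest is cycle-free and connects all
vertices, they correspond to the potentials `p : V → ℤ` with `p root = 0` and `|p u - p v| ≤ k`
for all edges `uv` (`ehrhartFunction_tensionPolytope`). In these coordinates the polytope is a
union of alcoves of the arrangement of all hyperplanes `x u - x v = m` with `m ∈ ℤ`, and the
alcoves are unimodular simplices.

Number the vertices by `0, …, d` and fix a generic point `q` with `0 = q 0 < ⋯ < q d < 1`. Remove
from every alcove the facets that separate it from `q`. The half-open alcoves obtained in this way
are disjoint, and since each tension polytope contains `q` and is bounded by hyperplanes of the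
arrangement, it is the disjoint union of the half-open alcoves in it (`mem_potentials_iff`). A
half-open alcove that lacks `i` facets has `(k + d - i).choose d` lattice points in its `k`-th
dilate (`ncard_alcove_points`), so it contributes `z ^ i` to the `h*`-polynomial. Hence `h*_i` is
the number of alcoves in the polytope that lack exactly `i` facets (`hStar_potentialPolynomial`).
As the half-open alcoves do not depend on the graph, `h*_i` can only grow if edges are deleted
(`hStar_potentialPolynomial_anti`).

Now compare the graph with the complete graph on its vertices and with its spanning tree. For the
complete graph the potentials, shifted to have minimum `0`, are the functions `V → {0, …, k}` with
a zero, and there are `(k + 1) ^ n - k ^ n` of them (`ncard_potentials_of_forall`). For the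
spanning tree the differences along its edges are arbitrary numbers in `{-k, …, k}`, so there are
`(2 * k + 1) ^ (n - 1)` potentials (`ncard_potentials_spanningForest`); that the tree has `n - 1`
edges follows by comparing degrees.

An alcove is encoded by the integer parts `a v` of the coordinates of an interior point and the
permutation that sorts their fractional parts. Its half-open version consists of the points whose
fractional parts increase weakly along the permutation, and strictly at each descent of the labels
`(-a v, v)`; so the missing facets are counted by descents.
-/

/-! ### The `h*`-vectors of the two bounds -/

theorem PowerSeries.coeff_one_sub_X_pow (m j : ℕ) :
    PowerSeries.coeff j ((1 - PowerSeries.X : PowerSeries ℚ) ^ m) = (-1) ^ j * (m.choose j : ℚ) := by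
  have h : (1 - PowerSeries.X : PowerSeries ℚ) =
      PowerSeries.evalNegHom (((1 + Polynomial.X : Polynomial ℚ) : PowerSeries ℚ)) := by
    simp [PowerSeries.evalNegHom, sub_eq_add_neg]
  rw [h, ← map_pow, ← Polynomial.coe_pow, PowerSeries.evalNegHom, PowerSeries.coeff_rescale,
    Polynomial.coeff_coe, Polynomial.coeff_one_add_X_pow]

theorem PowerSeries.coeff_one_sub_X_pow_mul_mk (m i : ℕ) (f : ℕ → ℚ) :
    PowerSeries.coeff i ((1 - PowerSeries.X) ^ m * PowerSeries.mk f) =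
      ∑ j ∈ Finset.range (i + 1), (-1) ^ j * (m.choose j : ℚ) * f (i - j) := by
  rw [PowerSeries.coeff_mul, Finset.Nat.sum_antidiagonal_eq_sum_range_succ_mk]
  simp [PowerSeries.coeff_one_sub_X_pow]

theorem natDegree_X_add_one_pow_sub_X_pow {n : ℕ} (hn : 1 ≤ n) :
    ((Polynomial.X + 1 : Polynomial ℚ) ^ n - Polynomial.X ^ n).natDegree = n - 1 := by
  apply Polynomial.natDegree_eq_of_le_of_coeff_ne_zero
  · rw [Polynomial.natDegree_le_iff_coeff_eq_zero]
    intro m hm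
    rw [Polynomial.coeff_sub, Polynomial.coeff_X_add_one_pow, Polynomial.coeff_X_pow]
    rcases eq_or_ne m n with rfl | h
    · simp
    · rw [if_neg h, Nat.choose_eq_zero_of_lt (by omega)]; simp
  · rw [Polynomial.coeff_sub, Polynomial.coeff_X_add_one_pow, Polynomial.coeff_X_pow,
      if_neg (by omega), ← Nat.choose_symm (by omega), Nat.sub_sub_self hn]
    simp; omega

theorem natDegree_two_mul_X_add_one_pow (m : ℕ) :
    ((2 * Polynomial.X + 1 : Polynomial ℚ) ^ m).natDegree = m := by
  rw [Polynomial.natDegree_pow]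
  have : (2 * Polynomial.X + 1 : Polynomial ℚ).natDegree = 1 := by
    exact Polynomial.natDegree_linear (a := (2 : ℚ)) (b := 1) two_ne_zero
  rw [this, mul_one]

theorem hStar_X_add_one_pow_sub_X_pow {n : ℕ} (hn : 1 ≤ n) (i : ℕ) :
    hStar ((Polynomial.X + 1) ^ n - Polynomial.X ^ n) i = (eulerianNumber n (i + 1) : ℚ) := by
  rw [hStar, natDegree_X_add_one_pow_sub_X_pow hn, Nat.sub_add_cancel hn]
  -- `F = ∑ k ^ n z ^ k` satisfies `z ∑ ((k + 1) ^ n - k ^ n) z ^ k = (1 - z) F`.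
  have hF : (PowerSeries.X : PowerSeries ℚ) * PowerSeries.mk (fun k : ℕ =>
      ((Polynomial.X + 1 : Polynomial ℚ) ^ n - Polynomial.X ^ n).eval (k : ℚ)) =
      (1 - PowerSeries.X) * PowerSeries.mk (fun k : ℕ => (k : ℚ) ^ n) := by
    ext k
    cases k with
    | zero => simp [sub_mul, show n ≠ 0 by omega]
    | succ k => simp [sub_mul, PowerSeries.coeff_succ_X_mul]
  rw [← PowerSeries.coeff_succ_X_mul, mul_left_comm, hF, ← mul_assoc, ← pow_succ,
    PowerSeries.coeff_one_sub_X_pow_mul_mk, eulerianNumber, ← Nat.range_succ_eq_Icc_zero]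
  push_cast
  refine Finset.sum_congr rfl fun j hj => ?_
  rw [Nat.cast_sub (by simp at hj; omega)]
  push_cast; ring

theorem hStar_two_mul_X_add_one_pow {n : ℕ} (hn : 1 ≤ n) (i : ℕ) :
    hStar ((2 * Polynomial.X + 1) ^ (n - 1)) i = (macMahonNumber n (i + 1) : ℚ) := by
  rw [hStar, natDegree_two_mul_X_add_one_pow, Nat.sub_add_cancel hn,
    PowerSeries.coeff_one_sub_X_pow_mul_mk, ← Finset.sum_range_reflect, macMahonNumber,
    ← Finset.Ico_add_one_right_eq_Icc, Finset.sum_Ico_eq_sum_range]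
  push_cast
  refine Finset.sum_congr (by simp) fun j hj => ?_
  have hj' : j ≤ i := by simp at hj; omega
  rw [show i + 1 - (1 + j) = i - j by omega,
    Nat.sub_sub_self hj']
  simp only [Polynomial.eval_pow, Polynomial.eval_add, Polynomial.eval_mul, Polynomial.eval_X,
    Polynomial.eval_one, Polynomial.eval_ofNat]
  ring

/-- Polynomials that agree at all positive integers are equal. -/
theorem Polynomial.eq_of_eval_natCast_eq {p q : Polynomial ℚ}
    (h : ∀ k : ℕ, 1 ≤ k → p.eval (k : ℚ) = q.eval (k : ℚ)) : p = q := by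
  refine Polynomial.eq_of_infinite_eval_eq p q ?_
  refine Set.infinite_of_injective_forall_mem (f := fun k : ℕ => ((k + 1 : ℕ) : ℚ)) ?_ ?_
  · intro a b hab
    simpa using hab
  · intro k
    exact h (k + 1) (by omega)

/-! ### Polynomials with nonnegative `h*`-vectors -/

noncomputable section

/-- The polynomial in `k` whose value at every natural number `k` is `(k + e).choose d`. -/
def choosePolynomial (d e : ℕ) : Polynomial ℚ :=
  Polynomial.C ((d.factorial : ℚ)⁻¹) *
    (descPochhammer ℚ d).comp (Polynomial.X + Polynomial.C (e : ℚ))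

theorem choosePolynomial_eval (d e k : ℕ) :
    (choosePolynomial d e).eval (k : ℚ) = ((k + e).choose d : ℚ) := by
  rw [choosePolynomial, Polynomial.eval_mul, Polynomial.eval_C, Polynomial.eval_comp,
    Polynomial.eval_add, Polynomial.eval_X, Polynomial.eval_C, ← Nat.cast_add,
    descPochhammer_eval_eq_descFactorial, Nat.descFactorial_eq_factorial_mul_choose]
  have := Nat.factorial_ne_zero d
  push_cast
  field_simp

theorem natDegree_choosePolynomial (d e : ℕ) : (choosePolynomial d e).natDegree = d := by
  rw [choosePolynomial, Polynomial.natDegree_C_mul (by positivity), Polynomial.natDegree_comp,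
    Polynomial.natDegree_X_add_C, descPochhammer_natDegree, mul_one]

theorem leadingCoeff_choosePolynomial (d e : ℕ) :
    (choosePolynomial d e).leadingCoeff = (d.factorial : ℚ)⁻¹ := by
  rw [choosePolynomial, Polynomial.leadingCoeff_mul, Polynomial.leadingCoeff_C,
    Polynomial.leadingCoeff_comp (by rw [Polynomial.natDegree_X_add_C]; simp),
    (monic_descPochhammer ℚ d).leadingCoeff,
    Polynomial.leadingCoeff_X_add_C]
  simp

theorem mk_choosePolynomial_eval {d i : ℕ} (hi : i ≤ d) :
    (1 - PowerSeries.X) ^ (d + 1) *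
      PowerSeries.mk (fun k : ℕ => (choosePolynomial d (d - i)).eval (k : ℚ)) =
      PowerSeries.X ^ i := by
  have h : PowerSeries.mk (fun k : ℕ => (choosePolynomial d (d - i)).eval (k : ℚ)) =
      PowerSeries.X ^ i * PowerSeries.mk (fun k : ℕ => ((d + k).choose d : ℚ)) := by
    ext k
    rw [PowerSeries.coeff_X_pow_mul', PowerSeries.coeff_mk, choosePolynomial_eval]
    split_ifs with hk
    · rw [PowerSeries.coeff_mk]
      congr 2
      omega
    · rw [Nat.choose_eq_zero_of_lt (by omega), Nat.cast_zero]
  rw [h, mul_left_comm, mul_comm ((1 - PowerSeries.X) ^ (d + 1)),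
    PowerSeries.mk_add_choose_mul_one_sub_pow_eq_one, mul_one]

section

variable {α : Type*} (s : Finset α) (des : α → ℕ) (d : ℕ)

theorem natDegree_sum_choosePolynomial (hs : s.Nonempty) :
    (∑ a ∈ s, choosePolynomial d (d - des a)).natDegree = d := by
  apply Polynomial.natDegree_eq_of_le_of_coeff_ne_zero
  · exact Polynomial.natDegree_sum_le_of_forall_le _ _
      fun a _ => (natDegree_choosePolynomial d _).le
  · have h : ∀ a, (choosePolynomial d (d - des a)).coeff d = (d.factorial : ℚ)⁻¹ := fun a => by
      have := leadingCoeff_choosePolynomial d (d - des a)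
      rwa [Polynomial.leadingCoeff, natDegree_choosePolynomial] at this
    simp only [Polynomial.finsetSum_coeff, h, Finset.sum_const, nsmul_eq_mul]
    have := hs.card_pos
    positivity

theorem hStar_sum_choosePolynomial (hs : s.Nonempty) (hd : ∀ a ∈ s, des a ≤ d) (i : ℕ) :
    hStar (∑ a ∈ s, choosePolynomial d (d - des a)) i =
      ((s.filter fun a => des a = i).card : ℚ) := by
  rw [hStar, natDegree_sum_choosePolynomial s des d hs]
  have h : PowerSeries.mk (fun k : ℕ =>
      (∑ a ∈ s, choosePolynomial d (d - des a)).eval (k : ℚ)) =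
      ∑ a ∈ s, PowerSeries.mk
        (fun k : ℕ => (choosePolynomial d (d - des a)).eval (k : ℚ)) := by
    ext k
    simp [Polynomial.eval_finsetSum]
  rw [h, Finset.mul_sum, map_sum, Finset.sum_congr rfl fun a ha => by
    rw [mk_choosePolynomial_eval (hd a ha), PowerSeries.coeff_X_pow]]
  rw [Finset.card_filter]
  push_cast
  exact Finset.sum_congr rfl fun a _ => by simp only [eq_comm]

end

end

/-! ### Compositions, partial sums and sorting -/

theorem card_tuples_sum_eq (d m : ℕ) :
    Nat.card {g : Fin (d + 1) → ℕ // ∑ j, g j = m} = (m + d).choose d := by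
  rw [← Nat.card_congr (Sym.equivNatSumOfFintype (Fin (d + 1)) m), Nat.card_eq_fintype_card,
    Sym.card_sym_eq_choose, Fintype.card_fin, show d + 1 + m - 1 = m + d by omega,
    Nat.choose_symm_add]

theorem card_tuples_sum_add_eq {d i : ℕ} (hi : i ≤ d) (k : ℕ) :
    Nat.card {g : Fin (d + 1) → ℕ // ∑ j, g j + i = k} = (k + (d - i)).choose d := by
  by_cases h : i ≤ k
  · have e : ∀ g : Fin (d + 1) → ℕ, ∑ j, g j + i = k ↔ ∑ j, g j = k - i := fun g => by omega
    simp only [e]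
    rw [card_tuples_sum_eq, show k - i + d = k + (d - i) by omega]
  · rw [Nat.choose_eq_zero_of_lt (by omega)]
    have : IsEmpty {g : Fin (d + 1) → ℕ // ∑ j, g j + i = k} := ⟨fun g => by have := g.2; omega⟩
    exact Nat.card_of_isEmpty

theorem Fin.partialSum_last {M : Type*} [AddCommMonoid M] {n : ℕ} (f : Fin n → M) :
    Fin.partialSum f (Fin.last n) = ∑ j, f j := by
  simp [Fin.partialSum, List.take_of_length_le, List.sum_ofFn]

theorem Fin.partialSum_succ_sub_castSucc {n : ℕ} (S : Fin (n + 1) → ℤ) (h0 : S 0 = 0) :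
    Fin.partialSum (fun j : Fin n => S j.succ - S j.castSucc) = S := by
  funext j
  induction j using Fin.induction with
  | zero => simp [h0]
  | succ j ih => rw [Fin.partialSum_succ, ih]; ring

/-- The sorting permutation is stable: ties are broken by the index. -/
theorem Tuple.eq_sort_iff_strictMono {n : ℕ} {β : Type*} [LinearOrder β] {f : Fin n → β}
    {σ : Equiv.Perm (Fin n)} :
    σ = Tuple.sort f ↔ StrictMono fun j => toLex (f (σ j), σ j) := by
  rw [Tuple.eq_sort_iff]
  constructor
  · rintro ⟨h₁, h₂⟩ i j hij
    rw [Prod.Lex.toLex_lt_toLex]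
    rcases (h₁ hij.le).lt_or_eq with h | h
    · exact Or.inl h
    · exact Or.inr ⟨h, h₂ i j hij h⟩
  · intro h
    refine ⟨fun i j hij => ?_, fun i j hij he => ?_⟩
    · rcases hij.lt_or_eq with hij | rfl
      · rcases Prod.Lex.toLex_lt_toLex.1 (h hij) with h' | h'
        · exact h'.le
        · exact h'.1.le
      · exact le_rfl
    · rcases Prod.Lex.toLex_lt_toLex.1 (h hij) with h' | h'
      · exact absurd he h'.ne
      · exact h'.2

/-! ### Half-open alcoves and their lattice points -/

noncomputable section

/-- The integer part of `x / k`, where an integral quotient counts as belonging to the unit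
interval next to it on the side of `0`, and `0` to the interval `[0, 1]`. -/
def alcoveFloor (k : ℕ) (x : ℤ) : ℤ := if x ≤ 0 then x / k else (x - 1) / k

theorem alcoveFloor_eq_iff {k : ℕ} (hk : 1 ≤ k) {x b : ℤ} :
    alcoveFloor k x = b ↔ 0 ≤ x - k * b ∧ x - k * b ≤ k ∧ (x - k * b = 0 → b ≤ 0) ∧
      (x - k * b = k → 0 ≤ b) := by
  have hk' : (0 : ℤ) < k := by exact_mod_cast hk
  have key : ∀ y : ℤ, y / k = b ↔ 0 ≤ y - k * b ∧ y - k * b < k := fun y => by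
    rw [Int.ediv_eq_iff_of_pos hk', mul_comm]
    constructor <;> rintro ⟨h₁, h₂⟩ <;> constructor <;> linarith
  unfold alcoveFloor
  split_ifs with hx
  · rw [key]
    constructor
    · rintro ⟨h₁, h₂⟩
      exact ⟨h₁, h₂.le, fun h => by nlinarith, fun h => by omega⟩
    · rintro ⟨h₁, h₂, -, h₄⟩
      refine ⟨h₁, lt_of_le_of_ne h₂ fun h => ?_⟩
      nlinarith [h₄ h]
  · rw [key]
    constructor
    · rintro ⟨h₁, h₂⟩
      exact ⟨by linarith, by linarith, fun h => by linarith, fun h => by nlinarith⟩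
    · rintro ⟨h₁, h₂, h₃, -⟩
      have : x - k * b ≠ 0 := fun h => by nlinarith [h₃ h]
      constructor <;> omega

/-- The data of an alcove of the affine braid arrangement `x u - x v ∈ ℤ` in `ℝ^(d+1)`: the integer
parts of the coordinates of a generic point, and the permutation that sorts their fractional
parts. -/
abbrev Alcove (d : ℕ) := (Fin (d + 1) → ℤ) × Equiv.Perm (Fin (d + 1))

variable {d : ℕ}

/-- The alcove data that occur when the coordinate at `0` is normalized to be `0`. -/
def Alcove.IsNormalized (α : Alcove d) : Prop := α.1 0 = 0 ∧ α.2 0 = 0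

/-- The alcove whose half-open version contains `p / k`. A point on several alcoves is assigned to
the one that one enters when moving from it towards a point `0 = q 0 < q 1 < ⋯ < q d < 1`. -/
def alcoveOf (k : ℕ) (p : Fin (d + 1) → ℤ) : Alcove d :=
  (fun v => alcoveFloor k (p v),
    Tuple.sort fun v => toLex (p v - k * alcoveFloor k (p v), -alcoveFloor k (p v)))

/-- The labels by which ties between fractional parts are broken, in the order of the vertices of
the alcove. The last label belongs to the upper end `1` of the unit interval. -/
def Alcove.label (α : Alcove d) : Fin (d + 2) → ℤ ×ₗ Fin (d + 1) :=
  Fin.snoc (fun j : Fin (d + 1) => toLex (-α.1 (α.2 j), α.2 j)) (toLex (1, 0))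

/-- The fractional parts of `p / k`, scaled by `k`, in the order prescribed by the alcove, and
followed by the upper end `k`. -/
def Alcove.chain (α : Alcove d) (k : ℕ) (p : Fin (d + 1) → ℤ) : Fin (d + 2) → ℤ :=
  Fin.snoc (fun j : Fin (d + 1) => p (α.2 j) - k * α.1 (α.2 j)) (k : ℤ)

theorem Alcove.chain_zero (α : Alcove d) (hα : α.IsNormalized) {k : ℕ} {p : Fin (d + 1) → ℤ}
    (hp : p 0 = 0) : α.chain k p 0 = 0 := by
  rw [← Fin.castSucc_zero, Alcove.chain, Fin.snoc_castSucc, hα.2, hα.1, hp]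
  simp

open scoped Classical in
/-- The number of descents of the labels: the number of facets missing from the half-open
alcove. -/
def Alcove.des (α : Alcove d) : ℕ :=
  (Finset.univ.filter fun j : Fin (d + 1) => α.label j.succ ≤ α.label j.castSucc).card

/-- The label at the upper end exceeds the label at the vertex `0`, so there is an ascent. -/
theorem Alcove.des_le {α : Alcove d} (hα : α.IsNormalized) : α.des ≤ d := by
  classical
  by_contra! h
  have hall : ∀ j : Fin (d + 1), α.label j.succ ≤ α.label j.castSucc := by
    have : (Finset.univ.filter
        fun j : Fin (d + 1) => α.label j.succ ≤ α.label j.castSucc) = Finset.univ := by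
      apply Finset.eq_univ_of_card
      apply le_antisymm (Finset.card_le_univ _)
      rw [Fintype.card_fin]
      exact h
    intro j
    have hj := Finset.mem_univ j
    rw [← this] at hj
    exact (Finset.mem_filter.1 hj).2
  have hlast : α.label (Fin.last _) ≤ α.label 0 :=
    (Fin.antitone_iff_succ_le.2 hall) (Fin.zero_le _)
  have h0 : α.label 0 = toLex (0, 0) := by
    rw [← Fin.castSucc_zero, Alcove.label, Fin.snoc_castSucc, hα.2, hα.1, neg_zero]
  rw [h0, Alcove.label, Fin.snoc_last, Prod.Lex.toLex_le_toLex] at hlast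
  simp at hlast

/-- The lattice points of a dilated half-open alcove: the fractional parts increase weakly, and
strictly where the labels descend. -/
theorem alcoveOf_eq_iff {k : ℕ} (hk : 1 ≤ k) {α : Alcove d} (hα : α.IsNormalized)
    {p : Fin (d + 1) → ℤ} (hp : p 0 = 0) :
    alcoveOf k p = α ↔ StrictMono fun j => toLex (α.chain k p j, α.label j) := by
  obtain ⟨a, π⟩ := α
  obtain ⟨ha0, hπ0⟩ := hα
  simp only at ha0 hπ0
  have hsm : (StrictMono fun j => toLex (Alcove.chain (a, π) k p j, Alcove.label (a, π) j)) ↔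
      (StrictMono fun j => toLex (toLex (p (π j) - k * a (π j), -a (π j)), π j)) ∧
        ∀ v, p v - k * a v ≤ k ∧ (p v - k * a v = k → 0 ≤ a v) := by
    constructor
    · intro h
      constructor
      · intro i j hij
        have := h (Fin.castSucc_lt_castSucc_iff.2 hij)
        simp only [Alcove.chain, Alcove.label, Fin.snoc_castSucc, Prod.Lex.toLex_lt_toLex,
          toLex_inj, Prod.mk.injEq] at this ⊢
        tauto
      · intro v
        have := h (Fin.castSucc_lt_last (π.symm v))
        simp only [Alcove.chain, Alcove.label, Fin.snoc_castSucc, Fin.snoc_last,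
          Prod.Lex.toLex_lt_toLex, Equiv.apply_symm_apply, Fin.not_lt_zero, and_false,
          or_false] at this
        omega
    · rintro ⟨h₁, h₂⟩ i j hij
      obtain ⟨i, rfl⟩ := Fin.exists_castSucc_eq.2 (ne_of_lt (hij.trans_le (Fin.le_last j)))
      induction j using Fin.lastCases with
      | last =>
        have := h₂ (π i)
        simp only [Alcove.chain, Alcove.label, Fin.snoc_castSucc, Fin.snoc_last,
          Prod.Lex.toLex_lt_toLex, Fin.not_lt_zero, and_false, or_false]
        omega
      | cast j =>
        have := h₁ (Fin.castSucc_lt_castSucc_iff.1 hij)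
        simp only [Alcove.chain, Alcove.label, Fin.snoc_castSucc, Prod.Lex.toLex_lt_toLex,
          toLex_inj, Prod.mk.injEq] at this ⊢
        tauto
  rw [hsm]
  constructor
  · intro h
    have h1 : ∀ v, alcoveFloor k (p v) = a v := fun v => congrFun (congrArg Prod.fst h) v
    have h2 := (congrArg Prod.snd h).symm
    simp only [alcoveOf, h1] at h2
    exact ⟨Tuple.eq_sort_iff_strictMono.1 h2, fun v =>
      ⟨((alcoveFloor_eq_iff hk).1 (h1 v)).2.1, ((alcoveFloor_eq_iff hk).1 (h1 v)).2.2.2⟩⟩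
  · rintro ⟨h₁, h₂⟩
    have h1 : ∀ v, alcoveFloor k (p v) = a v := fun v => by
      rw [alcoveFloor_eq_iff hk]
      have h0 : 0 ≤ p v - k * a v ∧ (p v - k * a v = 0 → a v ≤ 0) := by
        rcases (Fin.zero_le (π.symm v)).lt_or_eq with hv | hv
        · have := h₁ hv
          simp only [Prod.Lex.toLex_lt_toLex, toLex_inj, Prod.mk.injEq, hπ0, hp, ha0,
            Equiv.apply_symm_apply] at this
          omega
        · have hv' : v = 0 := by rw [← hπ0, hv, Equiv.apply_symm_apply]
          subst hv'
          simp [hp, ha0]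
      exact ⟨h0.1, (h₂ v).1, h0.2, (h₂ v).2⟩
    have h2 := (Tuple.eq_sort_iff_strictMono
      (f := fun v => toLex (p v - k * a v, -a v))).2 h₁
    simp only [alcoveOf, h1]
    rw [← h2]

/-- A point of a half-open alcove is determined by its chain of fractional parts. -/
def alcovePointsEquivChains (k : ℕ) {α : Alcove d} (hα : α.IsNormalized) :
    {p : Fin (d + 1) → ℤ // p 0 = 0 ∧ StrictMono fun j => toLex (α.chain k p j, α.label j)} ≃
      {S : Fin (d + 2) → ℤ // S 0 = 0 ∧ S (Fin.last _) = k ∧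
        StrictMono fun j => toLex (S j, α.label j)} where
  toFun p := ⟨α.chain k p.1, α.chain_zero hα p.2.1,
    by rw [Alcove.chain, Fin.snoc_last], p.2.2⟩
  invFun S := ⟨fun v => S.1 (α.2.symm v).castSucc + k * α.1 v, by
      have : α.2.symm 0 = 0 := by rw [Equiv.symm_apply_eq, hα.2]
      simp [this, hα.1, S.2.1], by
      convert S.2.2.2 with j
      induction j using Fin.lastCases with
      | last => rw [Alcove.chain, Fin.snoc_last, S.2.2.1]
      | cast j => simp [Alcove.chain]⟩
  left_inv p := by
    ext v
    simp [Alcove.chain]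
  right_inv S := by
    ext j
    induction j using Fin.lastCases with
    | last => simp [Alcove.chain, S.2.2.1]
    | cast j => simp [Alcove.chain]

open scoped Classical in
/-- The chains are determined by their steps, diminished by `1` where there is a descent. -/
def alcoveChainsEquivTuples (k : ℕ) (α : Alcove d) :
    {S : Fin (d + 2) → ℤ // S 0 = 0 ∧ S (Fin.last _) = k ∧
        StrictMono fun j => toLex (S j, α.label j)} ≃
      {g : Fin (d + 1) → ℕ // ∑ j, g j + α.des = k} := by
  have hmono : ∀ S : Fin (d + 2) → ℤ, (StrictMono fun j => toLex (S j, α.label j)) ↔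
      ∀ j : Fin (d + 1), S j.castSucc +
        (if α.label j.succ ≤ α.label j.castSucc then 1 else 0) ≤ S j.succ := by
    intro S
    rw [Fin.strictMono_iff_lt_succ]
    refine forall_congr' fun j => ?_
    rw [Prod.Lex.toLex_lt_toLex]
    split_ifs with h
    · simp only [h.not_gt, and_false, or_false]
      exact Int.lt_iff_add_one_le
    · simp only [not_le.1 h, and_true]
      omega
  have hdes : (α.des : ℤ) =
      ∑ j : Fin (d + 1), (if α.label j.succ ≤ α.label j.castSucc then 1 else 0) := by
    rw [Alcove.des, Finset.card_filter]; push_cast; rfl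
  refine ⟨fun S => ⟨fun j => (S.1 j.succ - S.1 j.castSucc -
    (if α.label j.succ ≤ α.label j.castSucc then 1 else 0)).toNat, ?_⟩, fun g =>
    ⟨Fin.partialSum fun j => (g.1 j : ℤ) +
      (if α.label j.succ ≤ α.label j.castSucc then 1 else 0), by simp, ?_, ?_⟩, ?_, ?_⟩
  · obtain ⟨S, h0, hl, hS⟩ := S
    rw [hmono] at hS
    zify
    rw [hdes, ← hl, ← Finset.sum_add_distrib]
    conv_rhs => rw [← Fin.partialSum_succ_sub_castSucc S h0, Fin.partialSum_last]
    refine Finset.sum_congr rfl fun j _ => ?_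
    rw [Int.toNat_of_nonneg (by linarith [hS j])]
    ring
  · rw [Fin.partialSum_last, Finset.sum_add_distrib, ← hdes]
    exact_mod_cast g.2
  · rw [hmono]
    intro j
    rw [Fin.partialSum_succ]
    have : (0 : ℤ) ≤ g.1 j := by positivity
    linarith
  · rintro ⟨S, h0, hl, hS⟩
    rw [hmono] at hS
    apply Subtype.ext
    refine Eq.trans ?_ (Fin.partialSum_succ_sub_castSucc S h0)
    dsimp only
    congr 1
    funext j
    rw [Int.toNat_of_nonneg (by linarith [hS j])]
    ring
  · intro g
    ext j
    simp only [Fin.partialSum_succ]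
    omega

theorem ncard_alcove_points {k : ℕ} (hk : 1 ≤ k) {α : Alcove d} (hα : α.IsNormalized) :
    {p : Fin (d + 1) → ℤ | p 0 = 0 ∧ alcoveOf k p = α}.ncard = (k + (d - α.des)).choose d := by
  rw [← card_tuples_sum_add_eq (Alcove.des_le hα), ← Nat.card_coe_set_eq]
  refine Nat.card_congr (Equiv.trans (Equiv.subtypeEquivRight fun p => ?_)
    ((alcovePointsEquivChains k hα).trans (alcoveChainsEquivTuples k α)))
  exact and_congr_right fun hp => alcoveOf_eq_iff hk hα hp

end

/-! ### Bounded potentials as unions of half-open alcoves -/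

noncomputable section

/-- The integral potentials, normalized at `root`, whose differences along `R` are at
most `k` in absolute value. -/
def potentials {V : Type*} (root : V) (R : V → V → Prop) (k : ℕ) : Set (V → ℤ) :=
  {p | p root = 0 ∧ ∀ u v, R u v → |p u - p v| ≤ k}

theorem potentials_finite {V : Type*} [Finite V] (root : V) {R : V → V → Prop}
    (hR : ∀ u v, Relation.EqvGen R u v) (k : ℕ) : (potentials root R k).Finite := by
  have hb : ∀ u v, ∃ N : ℤ, ∀ p ∈ potentials root R k, |p u - p v| ≤ N := by
    intro u v
    induction hR u v with
    | rel u v h => exact ⟨k, fun p hp => hp.2 u v h⟩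
    | refl u => exact ⟨0, fun p _ => by simp⟩
    | symm u v _ ih =>
      obtain ⟨N, hN⟩ := ih
      exact ⟨N, fun p hp => by rw [abs_sub_comm]; exact hN p hp⟩
    | trans u v w _ _ ih₁ ih₂ =>
      obtain ⟨N, hN⟩ := ih₁
      obtain ⟨M, hM⟩ := ih₂
      exact ⟨N + M, fun p hp => (abs_sub_le (p u) (p v) (p w)).trans
        (add_le_add (hN p hp) (hM p hp))⟩
  choose N hN using fun v => hb v root
  refine (Set.Finite.pi (t := fun v => Set.Icc (-N v) (N v))
    fun v => Set.finite_Icc _ _).subset fun p hp v _ => ?_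
  have := hN v p hp
  rw [hp.1, sub_zero] at this
  exact abs_le.1 this

/-- Relabelling the vertices. -/
theorem ncard_potentials_congr {V W : Type*} (e : V ≃ W) (root : V) (R : V → V → Prop) (k : ℕ) :
    (potentials (e root) (fun a b => R (e.symm a) (e.symm b)) k).ncard =
      (potentials root R k).ncard := by
  rw [← Nat.card_coe_set_eq, ← Nat.card_coe_set_eq]
  refine Nat.card_congr ((e.symm.arrowCongr (Equiv.refl ℤ)).subtypeEquiv fun p => ?_)
  simp only [potentials, Set.mem_ofPred_eq, Equiv.arrowCongr_apply, Equiv.symm_symm,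
    Function.comp_apply, Equiv.coe_refl, id]
  refine and_congr_right fun _ => ?_
  constructor
  · intro h u v huv
    exact h _ _ (by simpa using huv)
  · intro h a b hab
    simpa using h _ _ hab

variable {d : ℕ}

/-- The alcove lies in the half-space `x u - x v ≤ 1`. -/
def Alcove.SubLeOne (α : Alcove d) (u v : Fin (d + 1)) : Prop :=
  α.1 u - α.1 v ≤ 0 ∨ (α.1 u - α.1 v = 1 ∧ α.2.symm u < α.2.symm v)

/-- A half-open alcove lies entirely on one side of each hyperplane `x u - x v = 1`. -/
theorem sub_le_iff_subLeOne {k : ℕ} (hk : 1 ≤ k) (p : Fin (d + 1) → ℤ) (u v : Fin (d + 1)) :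
    p u - p v ≤ k ↔ (alcoveOf k p).SubLeOne u v := by
  set α := alcoveOf k p with hα
  obtain ⟨a, π⟩ := α
  have ha : ∀ v, alcoveFloor k (p v) = a v := fun v =>
    (congrFun (congrArg Prod.fst hα) v).symm
  have hπ := congrArg Prod.snd hα
  simp only [alcoveOf, ha] at hπ
  rw [Tuple.eq_sort_iff_strictMono] at hπ
  have hbefore : π.symm u < π.symm v ↔
      toLex (toLex (p u - k * a u, -a u), u) < toLex (toLex (p v - k * a v, -a v), v) := by
    have := hπ.lt_iff_lt (a := π.symm u) (b := π.symm v)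
    simp only [Equiv.apply_symm_apply] at this
    exact this.symm
  obtain ⟨hu₁, hu₂, hu₃, hu₄⟩ := (alcoveFloor_eq_iff hk).1 (ha u)
  obtain ⟨hv₁, hv₂, hv₃, hv₄⟩ := (alcoveFloor_eq_iff hk).1 (ha v)
  have hk' : (1 : ℤ) ≤ k := by exact_mod_cast hk
  have hsub : p u - p v = k * (a u - a v) + ((p u - k * a u) - (p v - k * a v)) := by ring
  rw [Alcove.SubLeOne, hsub]
  simp only [hbefore, Prod.Lex.toLex_lt_toLex, toLex_inj, Prod.mk.injEq]
  generalize p u - k * a u = r at *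
  generalize p v - k * a v = s at *
  rcases lt_trichotomy (a u - a v) 1 with h | h | h
  · have : (k : ℤ) * (a u - a v) ≤ 0 :=
      mul_nonpos_of_nonneg_of_nonpos (by omega) (by omega)
    constructor
    · intro; left; omega
    · intro; omega
  · rw [h]
    omega
  -- Equality in `p u - p v ≤ k` would need `r = 0`, hence `a u ≤ 0`, and `s = k`, hence `0 ≤ a v`.
  · have : (k : ℤ) * 2 ≤ k * (a u - a v) := mul_le_mul_of_nonneg_left (by omega) (by omega)
    constructor
    · intro h'
      have hr : r = 0 := by omega
      have hs : s = k := by omega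
      have := hu₃ hr
      have := hv₄ hs
      omega
    · omega

/-- The normalized alcoves in the polytope `{x | |x u - x v| ≤ 1 for all R u v}`. -/
def admissibleAlcoves (R : Fin (d + 1) → Fin (d + 1) → Prop) : Set (Alcove d) :=
  {α | α.IsNormalized ∧ ∀ u v, R u v → α.SubLeOne u v ∧ α.SubLeOne v u}

theorem admissibleAlcoves_anti {R R' : Fin (d + 1) → Fin (d + 1) → Prop}
    (h : ∀ u v, R u v → R' u v) : admissibleAlcoves R' ⊆ admissibleAlcoves R :=
  fun _ hα => ⟨hα.1, fun u v huv => hα.2 u v (h u v huv)⟩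

theorem alcoveOf_isNormalized {k : ℕ} (hk : 1 ≤ k) {p : Fin (d + 1) → ℤ} (hp : p 0 = 0) :
    (alcoveOf k p).IsNormalized := by
  set α := alcoveOf k p with hα
  obtain ⟨a, π⟩ := α
  have ha : ∀ v, alcoveFloor k (p v) = a v := fun v =>
    (congrFun (congrArg Prod.fst hα) v).symm
  have hπ := congrArg Prod.snd hα
  simp only [alcoveOf, ha] at hπ
  rw [Tuple.eq_sort_iff_strictMono] at hπ
  have ha0 : a 0 = 0 := by rw [← ha 0, hp]; simp [alcoveFloor]
  refine ⟨ha0, ?_⟩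
  by_contra h0
  have hlt : (0 : Fin (d + 1)) < π.symm 0 := by
    rw [Fin.pos_iff_ne_zero, ne_eq, Equiv.symm_apply_eq]
    exact fun h => h0 h.symm
  have hlt' := hπ hlt
  obtain ⟨h₁, -, h₃, -⟩ := (alcoveFloor_eq_iff hk).1 (ha (π 0))
  simp only [Equiv.apply_symm_apply, hp, ha0, Prod.Lex.toLex_lt_toLex, toLex_inj,
    Prod.mk.injEq, Fin.not_lt_zero, and_false, or_false] at hlt'
  omega

theorem mem_potentials_iff {k : ℕ} (hk : 1 ≤ k) {R : Fin (d + 1) → Fin (d + 1) → Prop}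
    {p : Fin (d + 1) → ℤ} :
    p ∈ potentials 0 R k ↔ p 0 = 0 ∧ alcoveOf k p ∈ admissibleAlcoves R := by
  constructor
  · rintro ⟨h0, h⟩
    refine ⟨h0, alcoveOf_isNormalized hk h0, fun u v huv => ?_⟩
    rw [← sub_le_iff_subLeOne hk, ← sub_le_iff_subLeOne hk]
    have := abs_le.1 (h u v huv)
    constructor <;> linarith
  · rintro ⟨h0, -, h⟩
    refine ⟨h0, fun u v huv => ?_⟩
    have := h u v huv
    rw [← sub_le_iff_subLeOne hk, ← sub_le_iff_subLeOne hk] at this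
    rw [abs_le]
    constructor <;> linarith

theorem admissibleAlcoves_finite {R : Fin (d + 1) → Fin (d + 1) → Prop}
    (hR : ∀ u v, Relation.EqvGen R u v) : (admissibleAlcoves R).Finite := by
  -- Every half-open alcove contains a lattice point of its dilation by `d + 1`.
  refine ((potentials_finite 0 hR (d + 1)).image (alcoveOf (d + 1))).subset fun α hα => ?_
  have h := ncard_alcove_points (show 1 ≤ d + 1 by omega) hα.1
  have hne : {p : Fin (d + 1) → ℤ | p 0 = 0 ∧ alcoveOf (d + 1) p = α}.Nonempty := by
    apply Set.nonempty_of_ncard_ne_zero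
    rw [h]
    exact (Nat.choose_pos (by omega)).ne'
  obtain ⟨p, hp, rfl⟩ := hne
  exact ⟨p, (mem_potentials_iff (by omega)).2 ⟨hp, hα⟩, rfl⟩

theorem admissibleAlcoves_nonempty (R : Fin (d + 1) → Fin (d + 1) → Prop) :
    (admissibleAlcoves R).Nonempty :=
  ⟨alcoveOf 1 0, ((mem_potentials_iff le_rfl).1 ⟨rfl, fun u v _ => by simp⟩).2⟩

theorem ncard_potentials_eq_sum {R : Fin (d + 1) → Fin (d + 1) → Prop}
    (hR : ∀ u v, Relation.EqvGen R u v) {k : ℕ} (hk : 1 ≤ k) :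
    (potentials 0 R k).ncard =
      ∑ α ∈ (admissibleAlcoves_finite hR).toFinset, (k + (d - α.des)).choose d := by
  classical
  have hfin := potentials_finite 0 hR k
  rw [Set.ncard_eq_toFinset_card _ hfin, Finset.card_eq_sum_card_fiberwise (f := alcoveOf k)
    (t := (admissibleAlcoves_finite hR).toFinset)]
  · refine Finset.sum_congr rfl fun α hα => ?_
    rw [Set.Finite.mem_toFinset] at hα
    rw [← ncard_alcove_points hk hα.1, ← Set.ncard_coe_finset]
    congr 1
    ext p
    simp only [Finset.coe_filter, Set.Finite.mem_toFinset, Set.mem_ofPred_eq,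
      mem_potentials_iff hk]
    constructor
    · rintro ⟨⟨h0, -⟩, h⟩
      exact ⟨h0, h⟩
    · rintro ⟨h0, h⟩
      exact ⟨⟨h0, h ▸ hα⟩, h⟩
  · intro p hp
    simp only [Set.Finite.coe_toFinset] at hp ⊢
    exact ((mem_potentials_iff hk).1 hp).2

/-- The polynomial that counts the potentials; its `h*`-vector counts the admissible alcoves by
their number of descents. -/
def potentialPolynomial {R : Fin (d + 1) → Fin (d + 1) → Prop}
    (hR : ∀ u v, Relation.EqvGen R u v) : Polynomial ℚ :=
  ∑ α ∈ (admissibleAlcoves_finite hR).toFinset, choosePolynomial d (d - α.des)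

section

variable {R R' : Fin (d + 1) → Fin (d + 1) → Prop} (hR : ∀ u v, Relation.EqvGen R u v)
  (hR' : ∀ u v, Relation.EqvGen R' u v)

theorem potentialPolynomial_eval {k : ℕ} (hk : 1 ≤ k) :
    (potentialPolynomial hR).eval (k : ℚ) = (potentials 0 R k).ncard := by
  rw [ncard_potentials_eq_sum hR hk, potentialPolynomial, Polynomial.eval_finsetSum]
  push_cast
  exact Finset.sum_congr rfl fun α _ => choosePolynomial_eval d _ k

theorem natDegree_potentialPolynomial : (potentialPolynomial hR).natDegree = d :=
  natDegree_sum_choosePolynomial _ _ _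
    ((Set.Finite.toFinset_nonempty _).2 (admissibleAlcoves_nonempty R))

theorem hStar_potentialPolynomial (i : ℕ) :
    hStar (potentialPolynomial hR) i =
      (((admissibleAlcoves_finite hR).toFinset.filter fun α => α.des = i).card : ℚ) :=
  hStar_sum_choosePolynomial _ _ _
    ((Set.Finite.toFinset_nonempty _).2 (admissibleAlcoves_nonempty R))
    (fun _ hα => Alcove.des_le ((Set.Finite.mem_toFinset _).1 hα).1) i

/-- Monotonicity of the `h*`-vector: the half-open alcoves do not depend on the polytope that they
decompose. -/
theorem hStar_potentialPolynomial_anti (h : ∀ u v, R u v → R' u v) (i : ℕ) :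
    hStar (potentialPolynomial hR') i ≤ hStar (potentialPolynomial hR) i := by
  rw [hStar_potentialPolynomial, hStar_potentialPolynomial]
  exact_mod_cast Finset.card_le_card (Finset.filter_subset_filter _
    (Set.Finite.toFinset_subset_toFinset.2 (admissibleAlcoves_anti h)))

end

/-! ### Potentials of the complete graph -/

/-- Potentials whose differences are all at most `k`: shifting the minimum to `0` identifies them
with the functions to `{0, …, k}` that take the value `0`. -/
theorem ncard_potentials_of_forall {V : Type*} [Fintype V] (root : V) {R : V → V → Prop}
    (hR : ∀ u v, u ≠ v → R u v ∨ R v u) (k : ℕ) :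
    (potentials root R k).ncard + k ^ Fintype.card V = (k + 1) ^ Fintype.card V := by
  classical
  have hmem : ∀ p : V → ℤ, p ∈ potentials root R k ↔ p root = 0 ∧ ∀ u v, p u - p v ≤ k := by
    intro p
    refine and_congr_right fun _ => ⟨fun h u v => ?_, fun h u v _ => ?_⟩
    · rcases eq_or_ne u v with rfl | huv
      · simp
      · rcases hR u v huv with h' | h'
        · exact (abs_le.1 (h _ _ h')).2
        · linarith [(abs_le.1 (h _ _ h')).1]
    · rw [abs_le]
      constructor <;> linarith [h u v, h v u]
  let A : Finset (V → ℤ) := Fintype.piFinset fun _ => Finset.Icc 0 (k : ℤ)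
  let B : Finset (V → ℤ) := Fintype.piFinset fun _ => Finset.Icc 1 (k : ℤ)
  have hA : A.card = (k + 1) ^ Fintype.card V := by
    simp [A, Fintype.card_piFinset]
  have hB : B.card = k ^ Fintype.card V := by simp [B, Fintype.card_piFinset]
  have hBA : B ⊆ A := Fintype.piFinset_subset _ _ fun _ =>
    Finset.Icc_subset_Icc (by norm_num) le_rfl
  have himage : potentials root R k = (fun (f : V → ℤ) v => f v - f root) ''
      ((A \ B : Finset (V → ℤ)) : Set (V → ℤ)) := by
    ext p
    rw [hmem]
    constructor
    · rintro ⟨h0, h⟩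
      obtain ⟨m, -, hm⟩ := Finset.exists_min_image Finset.univ p ⟨root, Finset.mem_univ _⟩
      refine ⟨fun v => p v - p m, ?_, ?_⟩
      · simp only [Finset.coe_sdiff, Set.mem_sdiff, Finset.mem_coe, A, B, Fintype.mem_piFinset,
          Finset.mem_Icc]
        refine ⟨fun v => ⟨by linarith [hm v (Finset.mem_univ v)], h v m⟩, fun h' => ?_⟩
        have := (h' m).1
        simp at this
      · funext v
        simp [h0]
    · rintro ⟨f, hf, rfl⟩
      simp only [Finset.coe_sdiff, Set.mem_sdiff, Finset.mem_coe, A, B, Fintype.mem_piFinset,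
          Finset.mem_Icc] at hf
      refine ⟨by simp, fun u v => ?_⟩
      linarith [(hf.1 u).2, (hf.1 v).1]
  rw [himage, Set.InjOn.ncard_image, Set.ncard_coe_finset, Finset.card_sdiff_of_subset hBA, hA,
    hB, Nat.sub_add_cancel (Nat.pow_le_pow_left (by omega) _)]
  intro f hf g hg hfg
  have hzero : ∀ f ∈ ((A \ B : Finset (V → ℤ)) : Set (V → ℤ)), (∀ v, 0 ≤ f v) ∧ ∃ v, f v = 0 := by
    intro f hf
    simp only [Finset.coe_sdiff, Set.mem_sdiff, Finset.mem_coe, A, B, Fintype.mem_piFinset,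
      Finset.mem_Icc, not_forall] at hf
    obtain ⟨h₁, v, hv⟩ := hf
    exact ⟨fun v => (h₁ v).1, v, by have := h₁ v; omega⟩
  obtain ⟨hf₀, x, hx⟩ := hzero f hf
  obtain ⟨hg₀, y, hy⟩ := hzero g hg
  have hd : ∀ v, f v - f root = g v - g root := fun v => congrFun hfg v
  funext v
  have := hd x
  have := hd y
  have := hd v
  have := hf₀ y
  have := hg₀ x
  omega

end

noncomputable section

/-! ### Walks, paths and spanning forests -/

namespace DirectedMultigraph

variable {V E : Type*} {G : DirectedMultigraph V E}

theorem isWalk_append {l₁ l₂ : List (E × Bool)} {u w : V} :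
    G.IsWalk u (l₁ ++ l₂) w ↔ ∃ v, G.IsWalk u l₁ v ∧ G.IsWalk v l₂ w := by
  induction l₁ generalizing u with
  | nil => simp [IsWalk]
  | cons s l ih => simp [IsWalk, ih, and_assoc]

theorem start_not (s : E × Bool) : G.start (s.1, !s.2) = G.finish s := by
  obtain ⟨e, b⟩ := s
  cases b <;> rfl

theorem finish_not (s : E × Bool) : G.finish (s.1, !s.2) = G.start s := by
  obtain ⟨e, b⟩ := s
  cases b <;> rfl

/-- The vertices `u` and `v` are in the same component of the spanning subgraph with edge
set `S`. -/
def Joined (G : DirectedMultigraph V E) (S : Finset E) (u v : V) : Prop :=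
  ∃ l, (∀ s ∈ l, s.1 ∈ S) ∧ G.IsWalk u l v

theorem Joined.refl {S : Finset E} (u : V) : G.Joined S u u := ⟨[], by simp, rfl⟩

theorem Joined.trans {S : Finset E} {u v w : V} :
    G.Joined S u v → G.Joined S v w → G.Joined S u w := by
  rintro ⟨l₁, h₁, w₁⟩ ⟨l₂, h₂, w₂⟩
  refine ⟨l₁ ++ l₂, fun s hs => ?_, isWalk_append.2 ⟨v, w₁, w₂⟩⟩
  rcases List.mem_append.1 hs with hs | hs
  exacts [h₁ s hs, h₂ s hs]

theorem joined_step {S : Finset E} {s : E × Bool} (hs : s.1 ∈ S) :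
    G.Joined S (G.start s) (G.finish s) := ⟨[s], by simpa using hs, rfl, rfl⟩

theorem Joined.symm {S : Finset E} {u v : V} : G.Joined S u v → G.Joined S v u := by
  rintro ⟨l, hl, hw⟩
  induction l generalizing u with
  | nil => obtain rfl : u = v := hw; exact Joined.refl u
  | cons s l ih =>
    obtain ⟨rfl, hw⟩ := hw
    have h := joined_step (G := G) (s := (s.1, !s.2)) (hl s (by simp))
    rw [start_not, finish_not] at h
    exact (ih (fun s' hs' => hl s' (by simp [hs'])) hw).trans h

theorem joined_edge {S : Finset E} {e : E} (he : e ∈ S) : G.Joined S (G.tail e) (G.head e) :=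
  joined_step (s := (e, true)) he

theorem IsPath.exists_suffix {l : List (E × Bool)} {u v w : V} (hl : G.IsPath w l v)
    (hu : u ∈ w :: l.map G.finish) : ∃ l', l' ⊆ l ∧ G.IsPath u l' v := by
  induction l generalizing w with
  | nil =>
    obtain rfl : u = w := by simpa using hu
    exact ⟨[], by simp, hl⟩
  | cons s l ih =>
    rcases List.mem_cons.1 hu with rfl | hu
    · exact ⟨s :: l, by simp, hl⟩
    · obtain ⟨l', hl', hp⟩ := ih (w := G.finish s) ⟨hl.1.2, (List.nodup_cons.1 hl.2).2⟩ hu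
      exact ⟨l', fun x hx => List.mem_cons_of_mem _ (hl' hx), hp⟩

theorem Joined.exists_isPath {S : Finset E} {u v : V} (h : G.Joined S u v) :
    ∃ l, G.IsPath u l v ∧ ∀ s ∈ l, s.1 ∈ S := by
  obtain ⟨l, hl, hw⟩ := h
  induction l generalizing u with
  | nil => exact ⟨[], ⟨hw, by simp⟩, by simp⟩
  | cons s l ih =>
    obtain ⟨rfl, hw⟩ := hw
    obtain ⟨l', hp, hS⟩ := ih (fun s' hs' => hl s' (by simp [hs'])) hw
    by_cases hu : G.start s ∈ G.finish s :: l'.map G.finish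
    · obtain ⟨l'', hsub, hp'⟩ := hp.exists_suffix hu
      exact ⟨l'', hp', fun s' hs' => hS s' (hsub hs')⟩
    · refine ⟨s :: l', ⟨⟨rfl, hp.1⟩, List.nodup_cons.2 ⟨hu, hp.2⟩⟩, fun s' hs' => ?_⟩
      rcases List.mem_cons.1 hs' with rfl | hs'
      exacts [hl s' (by simp), hS s' hs']

theorem IsPath.nodup_edges {l : List (E × Bool)} {u v : V} (h : G.IsPath u l v) :
    (l.map Prod.fst).Nodup := by
  induction l generalizing u with
  | nil => simp
  | cons s l ih =>
    obtain ⟨⟨rfl, hw⟩, hn⟩ := h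
    rw [List.map_cons, List.nodup_cons] at hn
    rw [List.map_cons, List.nodup_cons]
    refine ⟨fun hs => ?_, ih ⟨hw, hn.2⟩⟩
    obtain ⟨s', hs', he⟩ := List.mem_map.1 hs
    -- The second traversal of an edge ends at one of the endpoints of the first.
    by_cases hb : s'.2 = s.2
    · obtain rfl : s' = s := Prod.ext he hb
      exact (List.nodup_cons.1 hn.2).1 (List.mem_map_of_mem hs')
    · have : s' = (s.1, !s.2) := Prod.ext he (Bool.eq_not.2 hb)
      apply hn.1
      rw [← finish_not s, ← this]
      exact List.mem_cons_of_mem _ (List.mem_map_of_mem hs')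

theorem IsCycleFree.mono {S S' : Finset E} (h : G.IsCycleFree S') (hS : S ⊆ S') :
    G.IsCycleFree S := fun u l hl => h u l fun s hs => hS (hl s hs)

theorem isCycleFree_empty : G.IsCycleFree ∅ := by
  rintro u (_ | ⟨s, l⟩) hl hc
  · exact hc.1 rfl
  · simpa using hl s (by simp)

/-- A path between the endpoints of a further edge closes a cycle with this edge. -/
theorem IsCycleFree.not_joined [DecidableEq E] {S : Finset E} {e : E}
    (h : G.IsCycleFree (insert e S))
    (he : e ∉ S) : ¬ G.Joined S (G.head e) (G.tail e) := by
  intro hj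
  obtain ⟨l, hp, hS⟩ := hj.exists_isPath
  refine h (G.head e) (l ++ [(e, true)]) ?_ ⟨by simp, ?_, ?_, ?_⟩
  · intro s hs
    rcases List.mem_append.1 hs with hs | hs
    · exact Finset.mem_insert_of_mem (hS s hs)
    · simp [List.mem_singleton.1 hs]
  · exact isWalk_append.2 ⟨_, hp.1, rfl, rfl⟩
  · rw [List.map_append, List.nodup_append_comm]
    exact hp.2
  · rw [List.map_append, List.nodup_append_comm]
    refine List.nodup_cons.2 ⟨fun he' => ?_, hp.nodup_edges⟩
    obtain ⟨s, hs, rfl⟩ := List.mem_map.1 he'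
    exact he (hS s hs)

/-- An edge between different components closes no cycle. -/
theorem IsCycleFree.insert [DecidableEq E] {S : Finset E} {e : E} (h : G.IsCycleFree S)
    (hj : ¬ G.Joined S (G.head e) (G.tail e)) : G.IsCycleFree (insert e S) := by
  intro u l hl hc
  by_cases he : e ∈ l.map Prod.fst
  · obtain ⟨s, hs, rfl⟩ := List.mem_map.1 he
    obtain ⟨l₁, l₂, rfl⟩ := List.append_of_mem hs
    obtain ⟨-, hw, -, hn⟩ := hc
    rw [isWalk_append] at hw
    obtain ⟨v, hw₁, rfl, hw₂⟩ := hw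
    rw [List.map_append, List.map_cons, List.nodup_middle, List.nodup_cons, List.mem_append] at hn
    push Not at hn
    have hmem : ∀ s' ∈ l₁ ++ s :: l₂, s'.1 ≠ s.1 → s'.1 ∈ S := fun s' hs' hne =>
      (Finset.mem_insert.1 (hl s' hs')).resolve_left hne
    -- The rest of the cycle joins the endpoints of the new edge.
    have h₁ : G.Joined S u (G.start s) := ⟨l₁, fun s' hs' => hmem s' (by simp [hs']) fun h' =>
      hn.1.1 (h' ▸ List.mem_map_of_mem hs'), hw₁⟩
    have h₂ : G.Joined S (G.finish s) u := ⟨l₂, fun s' hs' => hmem s' (by simp [hs']) fun h' =>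
      hn.1.2 (h' ▸ List.mem_map_of_mem hs'), hw₂⟩
    have h₃ := h₂.trans h₁
    obtain ⟨e, b⟩ := s
    cases b
    · exact hj h₃.symm
    · exact hj h₃
  · refine h u l (fun s hs => ?_) hc
    exact (Finset.mem_insert.1 (hl s hs)).resolve_left fun h' => he (h' ▸ List.mem_map_of_mem hs)

theorem IsSpanningForest.joined {T : Finset E} (hT : G.IsSpanningForest T) (hG : G.Connected)
    (u v : V) : G.Joined T u v := by
  classical
  have hedge : ∀ e, G.Joined T (G.head e) (G.tail e) := by
    intro e
    by_cases he : e ∈ T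
    · exact (joined_edge he).symm
    · by_contra hj
      exact he (hT.2 (hT.1.insert hj) (Finset.subset_insert e T) (Finset.mem_insert_self e T))
  obtain ⟨l, hw⟩ := hG.2 u v
  induction l generalizing u with
  | nil => obtain rfl : u = v := hw; exact Joined.refl u
  | cons s l ih =>
    obtain ⟨rfl, hw⟩ := hw
    refine Joined.trans ?_ (ih _ hw)
    obtain ⟨e, b⟩ := s
    cases b
    · exact hedge e
    · exact (hedge e).symm

/-! ### Potentials and their differences -/

/-- On a cycle-free set of edges, the differences of a potential can be prescribed. -/
theorem IsCycleFree.exists_potential {S : Finset E} (h : G.IsCycleFree S) (x : E → ℤ) :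
    ∃ p : V → ℤ, ∀ e ∈ S, p (G.head e) - p (G.tail e) = x e := by
  classical
  induction S using Finset.induction_on with
  | empty => exact ⟨0, by simp⟩
  | insert e S he ih =>
    obtain ⟨p, hp⟩ := ih (h.mono (Finset.subset_insert e S))
    have hj := h.not_joined he
    refine ⟨fun v => p v + if G.Joined S (G.head e) v
      then x e - (p (G.head e) - p (G.tail e)) else 0, fun f hf => ?_⟩
    rcases Finset.mem_insert.1 hf with rfl | hf
    · simp only [if_pos (Joined.refl (G.head f)), if_neg hj]
      ring
    · have hiff : G.Joined S (G.head e) (G.head f) ↔ G.Joined S (G.head e) (G.tail f) :=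
        ⟨fun h' => h'.trans (joined_edge hf).symm, fun h' => h'.trans (joined_edge hf)⟩
      simp only [hiff]
      rw [← hp f hf]
      ring

theorem Joined.eq_of_forall_edge {S : Finset E} {u v : V} (h : G.Joined S u v) {q : V → ℤ}
    (hq : ∀ e ∈ S, q (G.head e) = q (G.tail e)) : q u = q v := by
  obtain ⟨l, hl, hw⟩ := h
  induction l generalizing u with
  | nil => exact congrArg q hw
  | cons s l ih =>
    obtain ⟨rfl, hw⟩ := hw
    rw [← ih (fun s' hs' => hl s' (by simp [hs'])) hw]
    have := hq s.1 (hl s (by simp))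
    obtain ⟨e, b⟩ := s
    cases b
    exacts [this, this.symm]

/-- The differences of a potential along the edges in `T`. -/
def difference (G : DirectedMultigraph V E) (T : Finset E) (p : V → ℤ) (f : T) : ℤ :=
  p (G.head f) - p (G.tail f)

/-- Normalized potentials and integral functions on a spanning forest correspond to each other by
taking differences. -/
theorem ncard_difference_eq {T : Finset E} (hT : G.IsSpanningForest T) (hG : G.Connected)
    (root : V) (P : (T → ℤ) → Prop) :
    {p : V → ℤ | p root = 0 ∧ P (G.difference T p)}.ncard = {x | P x}.ncard := by
  classical
  have himage : {x | P x} =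
      G.difference T '' {p : V → ℤ | p root = 0 ∧ P (G.difference T p)} := by
    ext x
    constructor
    · intro hx
      obtain ⟨p, hp⟩ := hT.1.exists_potential fun e => if h : e ∈ T then x ⟨e, h⟩ else 0
      have hd : G.difference T (fun v => p v - p root) = x := by
        funext f
        have := hp f f.2
        simp only [f.2, dite_true] at this
        simp only [difference]
        linarith
      exact ⟨fun v => p v - p root, ⟨by simp, by rw [hd]; exact hx⟩, hd⟩
    · rintro ⟨p, ⟨-, hp⟩, rfl⟩
      exact hp
  rw [himage, Set.InjOn.ncard_image]
  rintro p ⟨hp, -⟩ q ⟨hq, -⟩ hpq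
  funext v
  have := (hT.joined hG v root).eq_of_forall_edge (q := fun v => p v - q v) fun e he => by
    have := congrFun hpq ⟨e, he⟩
    simp only [difference] at this
    linarith
  simp only [hp, hq] at this
  linarith

theorem signVector_cons {s : E × Bool} {l : List (E × Bool)} (hs : s.1 ∉ l.map Prod.fst) (f : E)
    [Decidable (f = s.1)] :
    signVector (s :: l) f = (if f = s.1 then (if s.2 then 1 else -1) else 0) + signVector l f := by
  have hb : ∀ b, (s.1, b) ∉ l := fun b hb => hs (List.mem_map.2 ⟨_, hb, rfl⟩)
  obtain ⟨e, b⟩ := s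
  by_cases hf : f = e
  · subst hf
    cases b <;> simp [signVector, hb]
  · have h : ∀ c, (f, c) ∈ (e, b) :: l ↔ (f, c) ∈ l := by simp [hf]
    rw [if_neg hf, zero_add, signVector, signVector]
    classical exact if_congr (h true) rfl (if_congr (h false) rfl rfl)

/-- The sum of the differences of a potential along a walk telescopes. -/
theorem sum_signVector_mul_difference {T : Finset E} (p : V → ℤ) {l : List (E × Bool)} {u v : V}
    (hw : G.IsWalk u l v) (hn : (l.map Prod.fst).Nodup) (hl : ∀ s ∈ l, s.1 ∈ T) :
    ∑ f : T, signVector l f * G.difference T p f = p v - p u := by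
  classical
  induction l generalizing u with
  | nil =>
    obtain rfl : u = v := hw
    simp [signVector]
  | cons s l ih =>
    obtain ⟨rfl, hw⟩ := hw
    rw [List.map_cons, List.nodup_cons] at hn
    have hs := hl s (by simp)
    have key : ∀ f : T, signVector (s :: l) f * G.difference T p f =
        (if f = ⟨s.1, hs⟩ then (if s.2 then 1 else -1) * G.difference T p f else 0) +
          signVector l f * G.difference T p f := by
      intro f
      rw [signVector_cons hn.1, add_mul, ite_mul, zero_mul]
      simp only [Subtype.ext_iff]
    rw [Finset.sum_congr rfl fun f _ => key f, Finset.sum_add_distrib,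
      ih hw hn.2 fun s' hs' => hl s' (by simp [hs']), Finset.sum_ite_eq' Finset.univ]
    obtain ⟨e, b⟩ := s
    cases b <;> simp [difference, start, finish]

/-- The relation of being the tail and the head of an edge in `S`. -/
def Arc (G : DirectedMultigraph V E) (S : Finset E) (u v : V) : Prop :=
  ∃ e ∈ S, G.tail e = u ∧ G.head e = v

theorem Joined.eqvGen_arc {S : Finset E} {u v : V} (h : G.Joined S u v) :
    Relation.EqvGen (G.Arc S) u v := by
  obtain ⟨l, hl, hw⟩ := h
  induction l generalizing u with
  | nil => obtain rfl : u = v := hw; exact Relation.EqvGen.refl u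
  | cons s l ih =>
    obtain ⟨rfl, hw⟩ := hw
    refine Relation.EqvGen.trans _ _ _ ?_ (ih (fun s' hs' => hl s' (by simp [hs'])) hw)
    have hs := hl s (by simp)
    obtain ⟨e, b⟩ := s
    cases b
    · exact Relation.EqvGen.symm _ _ (Relation.EqvGen.rel _ _ ⟨e, hs, rfl, rfl⟩)
    · exact Relation.EqvGen.rel _ _ ⟨e, hs, rfl, rfl⟩

theorem mem_potentials_arc {S : Finset E} {root : V} {k : ℕ} {p : V → ℤ} :
    p ∈ potentials root (G.Arc S) k ↔
      p root = 0 ∧ ∀ e ∈ S, |p (G.head e) - p (G.tail e)| ≤ k := by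
  refine and_congr_right fun _ => ⟨fun h e he => ?_, ?_⟩
  · rw [abs_sub_comm]
    exact h _ _ ⟨e, he, rfl, rfl⟩
  · rintro h u v ⟨e, he, rfl, rfl⟩
    rw [abs_sub_comm]
    exact h e he

theorem treePath_spec {T : Finset E} (hT : G.IsSpanningForest T) (hG : G.Connected) (e : E) :
    G.IsPath (G.head e) (G.treePath T e) (G.tail e) ∧ ∀ s ∈ G.treePath T e, s.1 ∈ T := by
  have h := (hT.joined hG (G.head e) (G.tail e)).exists_isPath
  rw [treePath, dif_pos h]
  exact h.choose_spec

/-! ### The lattice points of the tension polytope -/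

theorem mem_smul_tensionPolytope {T : Finset E} {k : ℕ} (hk : 1 ≤ k) (x : T → ℝ) :
    x ∈ (k : ℝ) • G.tensionPolytope T ↔
      (∀ e, |((G.pathMatrix T).transpose.mulVec x) e| ≤ k) ∧ ∀ f, |x f| ≤ k := by
  have hk' : (0 : ℝ) < k := by exact_mod_cast hk
  have hscale : ∀ y : ℝ, (-1 ≤ (k : ℝ)⁻¹ * y ∧ (k : ℝ)⁻¹ * y ≤ 1) ↔ |y| ≤ k := fun y => by
    rw [← abs_le, abs_mul, abs_of_pos (inv_pos.2 hk'), inv_mul_le_iff₀ hk', mul_one]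
  rw [Set.mem_smul_set_iff_inv_smul_mem₀ hk'.ne']
  simp only [tensionPolytope, Set.mem_ofPred_eq, Matrix.mulVec_smul, Pi.smul_apply, smul_eq_mul,
    hscale]

theorem transpose_pathMatrix_mulVec_difference {T : Finset E} (hT : G.IsSpanningForest T)
    (hG : G.Connected) (p : V → ℤ) (e : {e : E // e ∉ T}) :
    ((G.pathMatrix T).transpose.mulVec fun f => (G.difference T p f : ℝ)) e =
      ((p (G.tail e) - p (G.head e) : ℤ) : ℝ) := by
  obtain ⟨hp, hmem⟩ := treePath_spec hT hG e.1
  rw [← sum_signVector_mul_difference p hp.1 hp.nodup_edges hmem]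
  simp [Matrix.mulVec, dotProduct, pathMatrix]

/-- The lattice points of the dilated tension polytope are the bounded differences of integral
potentials. -/
theorem ehrhartFunction_tensionPolytope [Fintype E] {T : Finset E} (hT : G.IsSpanningForest T)
    (hG : G.Connected) (root : V) {k : ℕ} (hk : 1 ≤ k) :
    ehrhartFunction (G.tensionPolytope T) k =
      (potentials root (G.Arc Finset.univ) k).ncard := by
  rw [ehrhartFunction, ← ncard_difference_eq hT hG root]
  congr 1
  ext p
  rw [mem_potentials_arc, Set.mem_ofPred_eq, mem_smul_tensionPolytope hk]
  refine and_congr_right fun _ => ?_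
  simp only [transpose_pathMatrix_mulVec_difference hT hG]
  have hcast : ∀ z : ℤ, |(z : ℝ)| ≤ k ↔ |z| ≤ k := fun z => by exact_mod_cast Iff.rfl
  simp only [hcast]
  constructor
  · rintro ⟨h₁, h₂⟩ e -
    by_cases he : e ∈ T
    · exact h₂ ⟨e, he⟩
    · rw [abs_sub_comm]
      exact h₁ ⟨e, he⟩
  · intro h
    refine ⟨fun e => ?_, fun f => h f (Finset.mem_univ _)⟩
    rw [abs_sub_comm]
    exact h e (Finset.mem_univ _)

theorem ncard_potentials_spanningForest {T : Finset E} (hT : G.IsSpanningForest T)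
    (hG : G.Connected) (root : V) (k : ℕ) :
    (potentials root (G.Arc T) k).ncard = (2 * k + 1) ^ T.card := by
  classical
  have h : potentials root (G.Arc T) k =
      {p | p root = 0 ∧ ∀ f, |G.difference T p f| ≤ k} := by
    ext p
    rw [mem_potentials_arc]
    exact and_congr_right fun _ => ⟨fun h f => h f f.2, fun h e he => h ⟨e, he⟩⟩
  have h' : {x : T → ℤ | ∀ f, |x f| ≤ k} =
      ((Fintype.piFinset fun _ => Finset.Icc (-(k : ℤ)) k : Finset (T → ℤ)) : Set (T → ℤ)) := by
    ext x
    simp [abs_le, forall_and, Pi.le_def]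
  rw [h, ncard_difference_eq hT hG root (fun x => ∀ f, |x f| ≤ k), h', Set.ncard_coe_finset,
    Fintype.card_piFinset]
  simp only [Int.card_Icc, Finset.prod_const, Finset.card_univ, Fintype.card_coe]
  congr 1
  omega

/-! ### Complete graphs and trees -/

theorem IsComplete.connected (hV : Nonempty V) (h : G.IsComplete) : G.Connected := by
  refine ⟨hV, fun u v => ?_⟩
  rcases eq_or_ne u v with rfl | huv
  · exact ⟨[], rfl⟩
  · obtain ⟨e, ⟨rfl, rfl⟩ | ⟨rfl, rfl⟩, -⟩ := h.2 u v huv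
    · exact ⟨[(e, true)], rfl, rfl⟩
    · exact ⟨[(e, false)], rfl, rfl⟩

theorem exists_isSpanningForest [Finite E] (G : DirectedMultigraph V E) :
    ∃ T, G.IsSpanningForest T := by
  obtain ⟨T, -, hT⟩ := Set.Finite.exists_le_maximal (Set.toFinite {S | G.IsCycleFree S})
    (isCycleFree_empty (G := G))
  exact ⟨T, hT⟩

/-- The complete graph on `Fin n`, with the edges oriented upwards. -/
def completeGraphFin (n : ℕ) : DirectedMultigraph (Fin n) {e : Fin n × Fin n // e.1 < e.2} where
  tail e := e.1.1
  head e := e.1.2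

theorem completeGraphFin_isComplete (n : ℕ) : (completeGraphFin n).IsComplete := by
  refine ⟨fun e => e.2.ne, fun u v huv => ?_⟩
  rcases lt_or_gt_of_ne huv with h | h
  · refine ⟨⟨(u, v), h⟩, Or.inl ⟨rfl, rfl⟩, ?_⟩
    rintro ⟨⟨a, b⟩, hab⟩ (⟨rfl, rfl⟩ | ⟨rfl, rfl⟩)
    · rfl
    · exact absurd h hab.not_gt
  · refine ⟨⟨(v, u), h⟩, Or.inr ⟨rfl, rfl⟩, ?_⟩
    rintro ⟨⟨a, b⟩, hab⟩ (⟨rfl, rfl⟩ | ⟨rfl, rfl⟩)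
    · exact absurd h hab.not_gt
    · rfl

/-- The star on `Fin (d + 1)` with centre `0`. -/
def starFin (d : ℕ) : DirectedMultigraph (Fin (d + 1)) (Fin d) where
  tail _ := 0
  head e := e.succ

theorem starFin_isTree (d : ℕ) : (starFin d).IsTree := by
  classical
  constructor
  · have hroot : ∀ v, (starFin d).Joined Finset.univ 0 v := fun v => by
      induction v using Fin.cases with
      | zero => exact Joined.refl _
      | succ e => exact joined_edge (G := starFin d) (Finset.mem_univ e)
    refine ⟨⟨0⟩, fun u v => ?_⟩
    obtain ⟨l, -, hl⟩ := (hroot u).symm.trans (hroot v)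
    exact ⟨l, hl⟩
  · suffices ∀ S, (starFin d).IsCycleFree S from this _
    intro S
    induction S using Finset.induction_on with
    | empty => exact isCycleFree_empty
    | insert e S he ih =>
      refine ih.insert ?_
      -- As long as `e` is missing, its head is an isolated vertex.
      rintro ⟨_ | ⟨⟨f, b⟩, l⟩, hl, hw⟩
      · exact Fin.succ_ne_zero e hw
      · have hf : f ∈ S := hl (f, b) (by simp)
        have hs := hw.1
        cases b
        · have : f = e := Fin.succ_injective _ hs
          exact he (this ▸ hf)
        · exact Fin.succ_ne_zero e hs.symm

/-! ### Ehrhart polynomials of graphs -/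

section

variable {d : ℕ}

theorem eqvGen_symm_apply {W : Type*} (e : V ≃ W) {R : V → V → Prop}
    (h : ∀ u v, Relation.EqvGen R u v) (a b : W) :
    Relation.EqvGen (fun a b => R (e.symm a) (e.symm b)) a b := by
  have key : ∀ u v, Relation.EqvGen R u v →
      Relation.EqvGen (fun a b => R (e.symm a) (e.symm b)) (e u) (e v) := by
    intro u v huv
    induction huv with
    | rel u v h => exact Relation.EqvGen.rel _ _ (by simpa using h)
    | refl u => exact Relation.EqvGen.refl _
    | symm u v _ ih => exact Relation.EqvGen.symm _ _ ih
    | trans u v w _ _ ih₁ ih₂ => exact Relation.EqvGen.trans _ _ _ ih₁ ih₂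
  simpa using key _ _ (h (e.symm a) (e.symm b))

/-- The number of potentials is a polynomial in the bound, for a relation on any set of `d + 1`
vertices. -/
theorem potentialPolynomial_eval_equiv (e : V ≃ Fin (d + 1)) {R : V → V → Prop}
    (h : ∀ u v, Relation.EqvGen R u v) {k : ℕ} (hk : 1 ≤ k) :
    (potentialPolynomial (eqvGen_symm_apply e h)).eval (k : ℚ) =
      (potentials (e.symm 0) R k).ncard := by
  rw [potentialPolynomial_eval _ hk, ← ncard_potentials_congr e (e.symm 0), Equiv.apply_symm_apply]

theorem potentialPolynomial_spanningForest (e : V ≃ Fin (d + 1)) {T : Finset E}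
    (hT : G.IsSpanningForest T) (hG : G.Connected) :
    potentialPolynomial (eqvGen_symm_apply e fun u v => (hT.joined hG u v).eqvGen_arc) =
      (2 * Polynomial.X + 1) ^ T.card := by
  refine Polynomial.eq_of_eval_natCast_eq fun k hk => ?_
  rw [potentialPolynomial_eval_equiv e (fun u v => (hT.joined hG u v).eqvGen_arc) hk,
    ncard_potentials_spanningForest hT hG]
  simp

/-- The number of edges of a spanning tree, read off from the degree of the polynomial that counts
the potentials. -/
theorem IsSpanningForest.card_eq (e : V ≃ Fin (d + 1)) {T : Finset E}
    (hT : G.IsSpanningForest T) (hG : G.Connected) : T.card = d := by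
  rw [← natDegree_two_mul_X_add_one_pow T.card, ← potentialPolynomial_spanningForest e hT hG,
    natDegree_potentialPolynomial]

theorem IsComplete.isEhrhartPolynomial [Fintype V] [Fintype E] {T : Finset E} (h : G.IsComplete)
    (hG : G.Connected) (hT : G.IsSpanningForest T) :
    IsEhrhartPolynomial (G.tensionPolytope T)
      ((Polynomial.X + 1) ^ Fintype.card V - Polynomial.X ^ Fintype.card V) := by
  intro k hk
  obtain ⟨root⟩ := hG.1
  have hcount := ncard_potentials_of_forall root (R := G.Arc Finset.univ) (fun u v huv => by
    obtain ⟨e, h' | h', -⟩ := h.2 u v huv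
    · exact Or.inl ⟨e, Finset.mem_univ _, h'⟩
    · exact Or.inr ⟨e, Finset.mem_univ _, h'⟩) k
  rw [ehrhartFunction_tensionPolytope hT hG root hk]
  simp only [Polynomial.eval_sub, Polynomial.eval_pow, Polynomial.eval_add, Polynomial.eval_X,
    Polynomial.eval_one]
  rw [sub_eq_iff_eq_add]
  exact_mod_cast hcount.symm

theorem IsTree.isEhrhartPolynomial [Fintype E] (e : V ≃ Fin (d + 1)) {T : Finset E}
    (h : G.IsTree) (hT : G.IsSpanningForest T) :
    IsEhrhartPolynomial (G.tensionPolytope T) ((2 * Polynomial.X + 1) ^ d) := by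
  intro k hk
  have hcard := hT.card_eq e h.1
  obtain rfl : T = Finset.univ := (Finset.subset_univ T).antisymm (hT.2 h.2 (Finset.subset_univ T))
  rw [ehrhartFunction_tensionPolytope hT h.1 (e.symm 0) hk,
    ncard_potentials_spanningForest hT h.1, hcard]
  simp

end

end DirectedMultigraph

theorem potentialPolynomial_of_forall {d : ℕ} {R : Fin (d + 1) → Fin (d + 1) → Prop}
    (h : ∀ u v, R u v) :
    potentialPolynomial (fun u v => Relation.EqvGen.rel u v (h u v)) =
      (Polynomial.X + 1) ^ (d + 1) - Polynomial.X ^ (d + 1) := by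
  refine Polynomial.eq_of_eval_natCast_eq fun k hk => ?_
  have hcount := ncard_potentials_of_forall 0 (fun u v _ => Or.inl (h u v)) k
  rw [Fintype.card_fin] at hcount
  rw [potentialPolynomial_eval _ hk]
  simp only [Polynomial.eval_sub, Polynomial.eval_pow, Polynomial.eval_add, Polynomial.eval_X,
    Polynomial.eval_one]
  rw [eq_sub_iff_add_eq]
  exact_mod_cast hcount

end

/-! ### The bounds and their tightness -/

theorem theorem7p7 (n : ℕ) (hn : 1 ≤ n) :
    -- the two bounds, for every connected graph on `n` vertices and every spanning forest
    (∀ (V : Type u) (E : Type v) [Fintype V] [Fintype E] (G : DirectedMultigraph V E)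
        (T : Finset E), Fintype.card V = n → G.Connected → G.IsSpanningForest T →
      ∃ L : Polynomial ℚ, IsEhrhartPolynomial (G.tensionPolytope T) L ∧ L.natDegree = n - 1 ∧
        ∀ i : ℕ, i ≤ n - 1 →
          (eulerianNumber n (i + 1) : ℚ) =
              hStar ((Polynomial.X + 1) ^ n - Polynomial.X ^ n) i ∧
          hStar ((Polynomial.X + 1) ^ n - Polynomial.X ^ n) i ≤ hStar L i ∧
          hStar L i ≤ hStar ((2 * Polynomial.X + 1) ^ (n - 1)) i ∧
          hStar ((2 * Polynomial.X + 1) ^ (n - 1)) i = (macMahonNumber n (i + 1) : ℚ)) ∧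
    -- the Ehrhart polynomial of the tension polytope of the complete graph
    (∀ (V : Type u) (E : Type v) [Fintype V] [Fintype E] (G : DirectedMultigraph V E)
        (T : Finset E), Fintype.card V = n → G.IsComplete → G.IsSpanningForest T →
      IsEhrhartPolynomial (G.tensionPolytope T)
        ((Polynomial.X + 1) ^ n - Polynomial.X ^ n)) ∧
    -- the Ehrhart polynomial of the tension polytope of a tree
    (∀ (V : Type u) (E : Type v) [Fintype V] [Fintype E] (G : DirectedMultigraph V E)
        (T : Finset E), Fintype.card V = n → G.IsTree → G.IsSpanningForest T →
      IsEhrhartPolynomial (G.tensionPolytope T) ((2 * Polynomial.X + 1) ^ (n - 1))) ∧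
    -- the lower bound is attained by a complete graph on `n` vertices
    (∃ (E : Type) (_ : Fintype E) (G : DirectedMultigraph (Fin n) E) (T : Finset E)
        (L : Polynomial ℚ), G.Connected ∧ G.IsComplete ∧ G.IsSpanningForest T ∧
      IsEhrhartPolynomial (G.tensionPolytope T) L ∧
        ∀ i : ℕ, i ≤ n - 1 → hStar L i = (eulerianNumber n (i + 1) : ℚ)) ∧
    -- the upper bound is attained by a tree on `n` vertices
    (∃ (E : Type) (_ : Fintype E) (G : DirectedMultigraph (Fin n) E) (T : Finset E)
        (L : Polynomial ℚ), G.Connected ∧ G.IsTree ∧ G.IsSpanningForest T ∧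
      IsEhrhartPolynomial (G.tensionPolytope T) L ∧
        ∀ i : ℕ, i ≤ n - 1 → hStar L i = (macMahonNumber n (i + 1) : ℚ)) := by
  obtain ⟨d, rfl⟩ : ∃ d, n = d + 1 := ⟨n - 1, by omega⟩
  have hsub : d + 1 - 1 = d := rfl
  have lower := hStar_X_add_one_pow_sub_X_pow hn
  have upper := hStar_two_mul_X_add_one_pow hn
  have hcomplete : ∀ (V : Type u) (E : Type v) [Fintype V] [Fintype E]
      (G : DirectedMultigraph V E) (T : Finset E), Fintype.card V = d + 1 → G.IsComplete →
      G.IsSpanningForest T → IsEhrhartPolynomial (G.tensionPolytope T)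
        ((Polynomial.X + 1) ^ (d + 1) - Polynomial.X ^ (d + 1)) := by
    intro V E _ _ G T hV hG hT
    rw [← hV]
    exact hG.isEhrhartPolynomial
      (hG.connected (Fintype.card_pos_iff.1 (by omega))) hT
  refine ⟨?_, hcomplete, ?_, ?_, ?_⟩
  · intro V E _ _ G T hV hG hT
    let e := Fintype.equivFinOfCardEq hV
    have hR : ∀ u v, Relation.EqvGen (G.Arc Finset.univ) u v := fun u v => by
      obtain ⟨l, hl⟩ := hG.2 u v
      exact DirectedMultigraph.Joined.eqvGen_arc ⟨l, fun s _ => Finset.mem_univ _, hl⟩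
    refine ⟨potentialPolynomial (DirectedMultigraph.eqvGen_symm_apply e hR), fun k hk => ?_,
      natDegree_potentialPolynomial _, fun i _ => ⟨(lower i).symm, ?_, ?_, upper i⟩⟩
    · rw [DirectedMultigraph.potentialPolynomial_eval_equiv e hR hk,
        DirectedMultigraph.ehrhartFunction_tensionPolytope hT hG (e.symm 0) hk]
    -- The total relation gives the polytope of the complete graph.
    · rw [← potentialPolynomial_of_forall (R := fun _ _ => True) fun _ _ => trivial]
      exact hStar_potentialPolynomial_anti _ _ (fun _ _ _ => trivial) i
    · have h := DirectedMultigraph.potentialPolynomial_spanningForest e hT hG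
      rw [hT.card_eq e hG] at h
      rw [hsub, ← h]
      refine hStar_potentialPolynomial_anti _ _ ?_ i
      rintro u v ⟨f, -, hf⟩
      exact ⟨f, Finset.mem_univ f, hf⟩
  · intro V E _ _ G T hV hG hT
    exact hG.isEhrhartPolynomial (Fintype.equivFinOfCardEq hV) hT
  · have hG := DirectedMultigraph.completeGraphFin_isComplete (d + 1)
    have hc := hG.connected ⟨0⟩
    obtain ⟨T, hT⟩ :=
      (DirectedMultigraph.completeGraphFin (d + 1)).exists_isSpanningForest
    refine ⟨_, inferInstance, _, T, _, hc, hG, hT, hG.isEhrhartPolynomial hc hT, fun i _ => ?_⟩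
    rw [Fintype.card_fin]
    exact lower i
  · have hG := DirectedMultigraph.starFin_isTree d
    exact ⟨_, inferInstance, _, Finset.univ, _, hG.1, hG, ⟨hG.2, fun S _ _ => Finset.subset_univ S⟩,
      hG.isEhrhartPolynomial (Equiv.refl _) ⟨hG.2, fun S _ _ => Finset.subset_univ S⟩,
      fun i _ => upper i⟩
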